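/- Let $\mathbf a=(a_1,a_2,a_3)\in\mathbb R^3$, $b\neq 0$, and consider the plant $\dot x_1=x_2,\ \dot x_2=x_3,\ \dot x_3=a_1x_1+a_2x_2+a_3x_3+d(t)+bu$ with output $y=x_1$, under the ADRC law $u=-\frac1{\hat b}(K\hat x+\hat d)$ with $\hat b\neq0$, $K=(k_1,k_2,k_3)\in\mathbb R^{3}$, and the extended state observer $\dot{\hat x}_1=\hat x_2-g_1(\hat x_1-y)$, $\dot{\hat x}_2=\hat x_3-g_2(\hat x_1-y)$, $\dot{\hat x}_3=\hat d+\hat b u-g_3(\hat x_1-y)$, $\dot{\hat d}=-g_4(\hat x_1-y)$, $G=(g_1,\dots,g_4)\in\mathbb R^4$. Let $d(t)=d_{ss}+\gamma(t)$ with $d_{ss}\in\mathbb R$ constant and $\gamma$ generated by $$\dot\chi=f_d(\chi),\qquad \gamma=C_d\chi, \tag{1}$$ where $\chi\in\mathbb R^M$, $f_d:\mathbb R^M\to\mathbb R^M$ is locally Lipschitz and $C_d\in\mathbb R^{1\times M}$. With $\tilde x=\hat x-x$, $\tilde d=\frac b{\hat b}\hat d-d_{ss}$, $\xi=(x,\tilde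 x,\tilde d)\in\mathbb R^7$ and $r=b/\hat b$, the closed loop is $$\dot\xi=A_{CL}\,\xi+B_{CL}C_d\,\chi,\qquad B_{CL}=[0,0,1,0,0,-1,0]^T, \tag{2}$$ $$A_{CL}=\begin{bmatrix} 0&1&0&0&0&0&0\\ 0&0&1&0&0&0&0\\ a_1-rk_1&a_2-rk_2&a_3-rk_3&-rk_1&-rk_2&-rk_3&-1\\ 0&0&0&-g_1&1&0&0\\ 0&0&0&-g_2&0&1&0\\ (r-1)k_1-a_1&(r-1)k_2-a_2&(r-1)k_3-a_3&(r-1)k_1-g_3&(r-1)k_2&(r-1)k_3&1\\ 0&0&0&-rg_4&0&0&0 \end{bmatrix}.$$ A system $\dot z=f(z)$ is called globally asymptotically stable to the origin if $f(0)=0$; from every initial state there is a solution on $[0,\infty)$; for every $\varepsilon>0$ there is $\delta>0$ such that every solution on $[0,\infty)$ with $\|z(0)\|<\delta$ satisfies $\|z(t)\|<\varepsilon$ for all $t\ge0$; and every solution on $[0,\infty)$ satisfies $z(t)\to0$ as $t\to\infty$. **Corollary (Stable Time-Varying Disturbance).** If $A_{CL}$ is Hurwitz (all its complex eigenvalues have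 negative real part) and the system (1) is globally asymptotically stable to the origin, then the cascade of (1) and (2), with state $(\xi,\chi)\in\mathbb R^{7+M}$, is globally asymptotically stable to the origin. -/

import Mathlib

open Filter Topology

noncomputable section

namespace ADRC

/-! ### Global asymptotic stability of an autonomous system `z' = f z` -/

/-- `z` solves `z' = f z` on `[0, ∞)` (two-sided derivative for `t > 0`, right derivative at `0`).
The values of `z` at negative times are irrelevant. -/
def IsForwardSolution {E : Type*} [NormedAddCommGroup E] [NormedSpace ℝ E]
    (f : E → E) (z : ℝ → E) : Prop :=
  ∀ t, 0 ≤ t → HasDerivWithinAt z (f (z t)) (Set.Ici 0) t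

/-- The system `z' = f z` is globally asymptotically stable to the origin: the origin is an
equilibrium, from each initial state there is a solution for all forward time, the origin is
stable in the sense of Lyapunov, and every solution converges to the origin. -/
structure IsGAS {E : Type*} [NormedAddCommGroup E] [NormedSpace ℝ E] (f : E → E) : Prop where
  equilibrium : f 0 = 0
  forward_complete : ∀ z₀ : E, ∃ z : ℝ → E, IsForwardSolution f z ∧ z 0 = z₀
  stable : ∀ ε : ℝ, 0 < ε → ∃ δ : ℝ, 0 < δ ∧ ∀ z : ℝ → E, IsForwardSolution f z →
    ‖z 0‖ < δ → ∀ t, 0 ≤ t → ‖z t‖ < ε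
  attractive : ∀ z : ℝ → E, IsForwardSolution f z → Tendsto z atTop (𝓝 0)

/-- A real square matrix is Hurwitz if all its complex eigenvalues have negative real part. -/
def IsHurwitz {n : Type*} [Fintype n] [DecidableEq n] (A : Matrix n n ℝ) : Prop :=
  ∀ μ ∈ spectrum ℂ (A.map (algebraMap ℝ ℂ)), μ.re < 0

/-! ### Plant, controller and observer -/

/-- Right-hand side of the plant in canonical form, with disturbance `d` and input `u`. -/
def plantField (a : Fin 3 → ℝ) (b : ℝ) (x : Fin 3 → ℝ) (d u : ℝ) : Fin 3 → ℝ :=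
  !![0, 1, 0; 0, 0, 1; a 0, a 1, a 2].mulVec x + d • ![0, 0, 1] + u • ![0, 0, b]

/-- The ADRC control law `u = -(1 / b̂) (K x̂ + d̂)`. -/
def control (bhat : ℝ) (K : Fin 3 → ℝ) (xhat : Fin 3 → ℝ) (dhat : ℝ) : ℝ :=
  -(1 / bhat) * (K ⬝ᵥ xhat + dhat)

/-- Right-hand side of the linear extended state observer for `(x̂, d̂)`, with input `u` and
measured output `y`. -/
def observerField (bhat : ℝ) (G : Fin 4 → ℝ) (xhat : Fin 3 → ℝ) (dhat u y : ℝ) : Fin 4 → ℝ :=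
  !![0, 1, 0, 0; 0, 0, 1, 0; 0, 0, 0, 1; 0, 0, 0, 0].mulVec
      ![xhat 0, xhat 1, xhat 2, dhat]
    + u • ![0, 0, bhat, 0] - (xhat 0 - y) • G

/-! ### Closed loop in the coordinates `(x, x̃, d̃)`,
`x̃ = x̂ - x`, `d̃ = (b / b̂) d̂ - d_ss` -/

/-- The closed-loop matrix `A_CL`, for arbitrary `b` and `b̂`. -/
def closedLoopMatrix (a : Fin 3 → ℝ) (b bhat : ℝ) (K : Fin 3 → ℝ) (G : Fin 4 → ℝ) :
    Matrix (Fin 7) (Fin 7) ℝ :=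
  let r := b / bhat
  !![0, 1, 0, 0, 0, 0, 0;
     0, 0, 1, 0, 0, 0, 0;
     a 0 - r * K 0, a 1 - r * K 1, a 2 - r * K 2, -(r * K 0), -(r * K 1), -(r * K 2), -1;
     0, 0, 0, -G 0, 1, 0, 0;
     0, 0, 0, -G 1, 0, 1, 0;
     (r - 1) * K 0 - a 0, (r - 1) * K 1 - a 1, (r - 1) * K 2 - a 2,
       (r - 1) * K 0 - G 2, (r - 1) * K 1, (r - 1) * K 2, 1;
     0, 0, 0, -(r * G 3), 0, 0, 0]

/-- `B_CL`, the column through which the time-varying part of the disturbance enters. -/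
def closedLoopInput : Matrix (Fin 7) (Fin 1) ℝ :=
  !![0; 0; 1; 0; 0; -1; 0]

/-- The matrices `A_CL` and `B_CL` are those of the loop formed by plant, control law and
observer: with disturbance `d = d_ss + γ`, the derivative of `(x, x̃, d̃)` dictated by the plant
and the observer is `A_CL (x, x̃, d̃) + B_CL γ`. -/
theorem closedLoop_eq (a : Fin 3 → ℝ) (b bhat : ℝ) (hbhat : bhat ≠ 0)
    (K : Fin 3 → ℝ) (G : Fin 4 → ℝ) (x xhat : Fin 3 → ℝ) (dhat dss γ : ℝ) :
    let u := control bhat K xhat dhat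
    let dx := plantField a b x (dss + γ) u
    let dobs := observerField bhat G xhat dhat u (x 0)
    ![dx 0, dx 1, dx 2, dobs 0 - dx 0, dobs 1 - dx 1, dobs 2 - dx 2, b / bhat * dobs 3]
      = (closedLoopMatrix a b bhat K G).mulVec
          ![x 0, x 1, x 2, xhat 0 - x 0, xhat 1 - x 1, xhat 2 - x 2, b / bhat * dhat - dss]
        + closedLoopInput.mulVec ![γ] := by
  intro u dx dobs
  ext i
  fin_cases i <;>
    simp [u, dx, dobs, control, plantField, observerField, closedLoopMatrix, closedLoopInput,
      dotProduct, Fin.sum_univ_succ, Matrix.vecHead, Matrix.vecTail] <;>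
    field_simp <;> ring

/-- Right-hand side of the cascade of the disturbance generator `χ' = f_d χ`, `γ = C_d χ`, and the
closed loop `ξ' = A_CL ξ + B_CL C_d χ`, where `ξ = (x, x̃, d̃)`. The state is `(ξ, χ)`. The norm
on the product is the maximum of the two Euclidean norms; it is equivalent to the Euclidean norm
on `ℝ^(7+M)`, so global asymptotic stability means the same for both. -/
def cascadeField (a : Fin 3 → ℝ) (b bhat : ℝ) (K : Fin 3 → ℝ) (G : Fin 4 → ℝ) {M : ℕ}
    (fd : EuclideanSpace ℝ (Fin M) → EuclideanSpace ℝ (Fin M)) (Cd : Matrix (Fin 1) (Fin M) ℝ)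
    (z : EuclideanSpace ℝ (Fin 7) × EuclideanSpace ℝ (Fin M)) :
    EuclideanSpace ℝ (Fin 7) × EuclideanSpace ℝ (Fin M) :=
  (Matrix.toEuclideanLin (closedLoopMatrix a b bhat K G) z.1
      + Matrix.toEuclideanLin (closedLoopInput * Cd) z.2,
    fd z.2)

end ADRC

end

/-! The generator is unaffected by `ξ`, so the loop is a linear system `ξ' = T ξ + u` with input `u
= N χ`. Exponential decay of `exp (t • T)` gives `‖ξ t‖ ≤ c e^{-lam (t - s)} ‖ξ s‖ + (c / lam)
sup_{[s,t]} ‖u‖` (`norm_le_of_hasDerivWithinAt_add`). With `s = 0` this yields stability, since `χ`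
stays small; with `s` large it yields convergence, since `χ` tends to zero. The decay follows from
the Hurwitz condition: the spectrum of `exp T` lies in the open unit disc, so its powers vanish
(`IsHurwitz.tendsto_exp_pow`), and the semigroup law passes from integer to real times. -/

open NormedSpace

/-! ### Spectral theory: from a Hurwitz matrix to vanishing powers of its exponential. -/

namespace ContinuousLinearMap

section Complex

variable {V : Type*} [NormedAddCommGroup V] [NormedSpace ℂ V]

theorem mem_spectrum_iff_exists_eigenvector [FiniteDimensional ℂ V] (S : V →L[ℂ] V) (μ : ℂ) :
    μ ∈ spectrum ℂ S ↔ ∃ v, v ≠ 0 ∧ S v = μ • v := by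
  have h : spectrum ℂ (Module.End.toContinuousLinearMap V (S : V →ₗ[ℂ] V))
      = spectrum ℂ (S : V →ₗ[ℂ] V) := AlgEquiv.spectrum_eq _ _
  have hS : Module.End.toContinuousLinearMap V (S : V →ₗ[ℂ] V) = S := by ext; rfl
  rw [hS] at h
  rw [h, ← Module.End.hasEigenvalue_iff_mem_spectrum]
  constructor
  · intro h
    obtain ⟨v, hv⟩ := h.exists_hasEigenvector
    exact ⟨v, hv.2, hv.apply_eq_smul⟩
  · rintro ⟨v, hv0, hv⟩
    exact Module.End.hasEigenvalue_of_hasEigenvector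
      ⟨Module.End.mem_eigenspace_iff.2 hv, hv0⟩

theorem exp_apply_of_apply_eq_smul [CompleteSpace V] {S : V →L[ℂ] V} {μ : ℂ} {v : V}
    (hv : S v = μ • v) : exp S v = Complex.exp μ • v := by
  have h1 := (exp_series_hasSum_exp' (𝕂 := ℂ) S).mapL (ContinuousLinearMap.apply ℂ V v)
  have h2 := (exp_series_hasSum_exp' (𝕂 := ℂ) μ).mapL
    (ContinuousLinearMap.toSpanSingleton ℂ v)
  have hpow : ∀ n : ℕ, (S ^ n) v = μ ^ n • v := by
    intro n
    induction n with
    | zero => simp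
    | succ n ih => rw [pow_succ', mul_apply_eq_comp, ih, map_smul, hv, smul_smul, pow_succ]
  rw [Complex.exp_eq_exp_ℂ]
  refine h1.unique ?_
  simpa [hpow, smul_smul] using h2

/-- Every point of the spectrum of `exp S` is the exponential of a point of the spectrum of `S`. -/
theorem exists_mem_spectrum_of_mem_spectrum_exp [FiniteDimensional ℂ V] (S : V →L[ℂ] V) {ν : ℂ}
    (hν : ν ∈ spectrum ℂ (exp S)) : ∃ μ ∈ spectrum ℂ S, ν = Complex.exp μ := by
  have : CompleteSpace V := FiniteDimensional.complete ℂ V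
  have hc : ∀ v, S (exp S v) = exp S (S v) := fun v ↦
    DFunLike.congr_fun ((Commute.refl S).exp_right).eq v
  obtain ⟨v, hv0, hv⟩ := (mem_spectrum_iff_exists_eigenvector _ _).1 hν
  -- The `ν`-eigenspace of `exp S` is `S`-invariant because `S` commutes with `exp S`; an
  -- eigenvector of `S` inside it supplies `μ`.
  let W : Submodule ℂ V := LinearMap.ker ((exp S - ν • (1 : V →L[ℂ] V) : V →L[ℂ] V) : V →ₗ[ℂ] V)
  have hW : ∀ w, w ∈ W ↔ exp S w = ν • w := fun w ↦ by
    simp [W, sub_eq_zero]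
  have : Nontrivial W := ⟨⟨v, (hW v).2 hv⟩, 0, fun h ↦ hv0 (congrArg Subtype.val h)⟩
  let R : Module.End ℂ W := (S : V →ₗ[ℂ] V).restrict (p := W) (q := W) fun w hw ↦ by
    rw [hW] at hw ⊢
    change exp S (S w) = ν • S w
    rw [← hc, hw, map_smul]
  obtain ⟨μ, hμ⟩ := Module.End.exists_eigenvalue R
  obtain ⟨w, hw⟩ := hμ.exists_hasEigenvector
  have hw0 : (w : V) ≠ 0 := fun h ↦ hw.2 (Subtype.ext h)
  have hSw : S w = μ • (w : V) := congrArg Subtype.val hw.apply_eq_smul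
  refine ⟨μ, (mem_spectrum_iff_exists_eigenvector _ _).2 ⟨w, hw0, hSw⟩, ?_⟩
  have h := exp_apply_of_apply_eq_smul hSw
  rw [(hW w).1 w.2] at h
  exact smul_left_injective ℂ hw0 h

end Complex

end ContinuousLinearMap

/-- Gelfand's formula: the spectral radius is below some `q < 1`, so eventually `‖a ^ n‖ ≤ q ^ n`.
-/
theorem spectrum.tendsto_pow_zero_of_forall_norm_lt_one {A : Type*} [NormedRing A]
    [NormedAlgebra ℂ A] [CompleteSpace A] [Nontrivial A] (a : A)
    (h : ∀ z ∈ spectrum ℂ a, ‖z‖ < 1) : Tendsto (fun n : ℕ ↦ a ^ n) atTop (𝓝 0) := by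
  have hr : spectralRadius ℂ a < (1 : NNReal) :=
    spectrum.spectralRadius_lt_of_forall_lt a fun z hz ↦ h z hz
  obtain ⟨q, hq, hq1⟩ := ENNReal.lt_iff_exists_nnreal_btwn.1 hr
  have hq1 : q < 1 := by exact_mod_cast hq1
  have hev := (spectrum.pow_nnnorm_pow_one_div_tendsto_nhds_spectralRadius a).eventually_lt_const hq
  refine squeeze_zero_norm' ?_ (tendsto_pow_atTop_nhds_zero_of_lt_one q.2 hq1)
  filter_upwards [hev, eventually_gt_atTop 0] with n hn hn0
  have hn0' : (0 : ℝ) < n := by exact_mod_cast hn0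
  have := (ENNReal.rpow_lt_rpow hn hn0').le
  rw [← ENNReal.rpow_mul, one_div_mul_cancel hn0'.ne', ENNReal.rpow_one, ENNReal.rpow_natCast] at this
  exact_mod_cast this

namespace ADRC

variable {n : Type*} [Fintype n] [DecidableEq n]

/-- The spectral argument runs over `ℂ`. Complexification is a continuous ring homomorphism, hence
commutes with `exp` and powers; the entrywise real part, continuous and left inverse to it, brings
the limit back to `ℝ`. -/
theorem IsHurwitz.tendsto_exp_pow [Nonempty n] {A : Matrix n n ℝ} (hA : IsHurwitz A) :
    Tendsto (fun k : ℕ ↦ exp (Matrix.toEuclideanCLM (𝕜 := ℝ) A) ^ k) atTop (𝓝 0) := by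
  let _ : NormedAlgebra ℚ (EuclideanSpace ℝ n →L[ℝ] EuclideanSpace ℝ n) :=
    NormedAlgebra.restrictScalars ℚ ℝ _
  let eR := Matrix.toEuclideanCLM (𝕜 := ℝ) (n := n)
  let eC := Matrix.toEuclideanCLM (𝕜 := ℂ) (n := n)
  have heR : Continuous eR :=
    LinearMap.continuous_of_finiteDimensional eR.toAlgEquiv.toLinearMap
  have heR' : Continuous eR.symm :=
    LinearMap.continuous_of_finiteDimensional eR.symm.toAlgEquiv.toLinearMap
  have heC : Continuous eC :=
    LinearMap.continuous_of_finiteDimensional eC.toAlgEquiv.toLinearMap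
  have heC' : Continuous eC.symm :=
    LinearMap.continuous_of_finiteDimensional eC.symm.toAlgEquiv.toLinearMap
  -- the complexification of operators, and its left inverse `re`
  let φ : (EuclideanSpace ℝ n →L[ℝ] EuclideanSpace ℝ n) →+*
      (EuclideanSpace ℂ n →L[ℂ] EuclideanSpace ℂ n) :=
    (eC : Matrix n n ℂ →+* _).comp ((algebraMap ℝ ℂ).mapMatrix.comp (eR.symm : _ →+* Matrix n n ℝ))
  have hφ_apply : ∀ T, φ T = eC ((eR.symm T).map (algebraMap ℝ ℂ)) := fun T ↦ rfl
  have hφ : Continuous φ :=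
    heC.comp (heR'.matrix_map Complex.continuous_ofReal)
  let re : (EuclideanSpace ℂ n →L[ℂ] EuclideanSpace ℂ n) →
      (EuclideanSpace ℝ n →L[ℝ] EuclideanSpace ℝ n) := fun S ↦ eR ((eC.symm S).map Complex.re)
  have hre : Continuous re := heR.comp (heC'.matrix_map Complex.continuous_re)
  have hre_φ : ∀ T, re (φ T) = T := fun T ↦ by
    have : (eR.symm T).map (Complex.re ∘ algebraMap ℝ ℂ) = eR.symm T := by ext; simp
    simp only [re, hφ_apply, StarAlgEquiv.symm_apply_apply, Matrix.map_map, this,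
      StarAlgEquiv.apply_symm_apply]
  have hcomplex : Tendsto (fun k : ℕ ↦ exp (φ (eR A)) ^ k) atTop (𝓝 0) := by
    refine spectrum.tendsto_pow_zero_of_forall_norm_lt_one _ fun z hz ↦ ?_
    obtain ⟨μ, hμ, rfl⟩ := ContinuousLinearMap.exists_mem_spectrum_of_mem_spectrum_exp _ hz
    rw [hφ_apply, StarAlgEquiv.symm_apply_apply, AlgEquiv.spectrum_eq eC] at hμ
    rw [Complex.norm_exp, Real.exp_lt_one_iff]
    exact hA μ hμ
  have h := (hre.tendsto 0).comp hcomplex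
  have h0 : re 0 = 0 := by rw [← map_zero φ, hre_φ]
  rw [h0] at h
  refine h.congr fun k ↦ ?_
  rw [Function.comp_apply, ← map_exp φ hφ, ← map_pow, hre_φ]

end ADRC

/-! ### Exponential decay and linear systems with input. -/

namespace ContinuousLinearMap

variable {E : Type*} [NormedAddCommGroup E] [NormedSpace ℝ E] [CompleteSpace E]

theorem exp_add_smul (T : E →L[ℝ] E) (s t : ℝ) :
    exp ((s + t) • T) = exp (s • T) * exp (t • T) := by
  let _ : NormedAlgebra ℚ (E →L[ℝ] E) := NormedAlgebra.restrictScalars ℚ ℝ _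
  rw [add_smul, exp_add_of_commute (((Commute.refl T).smul_left s).smul_right t)]

theorem exp_natCast_smul (T : E →L[ℝ] E) (k : ℕ) : exp ((k : ℝ) • T) = exp T ^ k := by
  let _ : NormedAlgebra ℚ (E →L[ℝ] E) := NormedAlgebra.restrictScalars ℚ ℝ _
  rw [Nat.cast_smul_eq_nsmul, exp_nsmul]

theorem continuous_exp_smul (T : E →L[ℝ] E) : Continuous fun t : ℝ ↦ exp (t • T) :=
  continuous_iff_continuousAt.2 fun t ↦ (hasDerivAt_exp_smul_const T t).continuousAt

/-- If the powers of `exp T` tend to zero, then `exp (t • T)` decays exponentially. -/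
theorem exists_norm_exp_smul_le_of_tendsto_pow {T : E →L[ℝ] E}
    (hT : Tendsto (fun k : ℕ ↦ exp T ^ k) atTop (𝓝 0)) :
    ∃ c lam : ℝ, 0 < c ∧ 0 < lam ∧ ∀ t : ℝ, 0 ≤ t →
      ‖exp (t • T)‖ ≤ c * Real.exp (-(lam * t)) := by
  have hsmall : ∀ᶠ k : ℕ in atTop, ‖exp T ^ k‖ < Real.exp (-1) := by
    have := hT.norm
    rw [norm_zero] at this
    exact this.eventually_lt_const (Real.exp_pos _)
  obtain ⟨k, hk, hk0⟩ := (hsmall.and (eventually_gt_atTop 0)).exists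
  have hk0 : (0 : ℝ) < k := by exact_mod_cast hk0
  obtain ⟨C, hC⟩ := (isCompact_Icc (a := (0 : ℝ)) (b := k)).exists_bound_of_continuousOn
    (continuous_exp_smul T).continuousOn
  have hC0 : 0 ≤ C := (norm_nonneg _).trans (hC 0 ⟨le_rfl, hk0.le⟩)
  -- Each full block of length `k` contributes a factor `e⁻¹`, whence the rate `1 / k`. The
  -- incomplete block costs at most `C`, and rounding `t / k` down costs the factor `e`.
  refine ⟨(C + 1) * Real.exp 1, 1 / k, by positivity, by positivity, fun t ht ↦ ?_⟩
  set m : ℕ := ⌊t / k⌋₊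
  have hm1 : (m : ℝ) ≤ t / k := Nat.floor_le (by positivity)
  have hm2 : t / k < m + 1 := Nat.lt_floor_add_one _
  have hm1' : m * k ≤ t := (le_div_iff₀ hk0).1 hm1
  have hm2' : t < (m + 1) * k := (div_lt_iff₀ hk0).1 hm2
  have hdecomp : exp (t • T) = exp ((t - m * k) • T) * (exp T ^ k) ^ m := by
    rw [← pow_mul, ← exp_natCast_smul, ← exp_add_smul]
    congr 2
    push_cast
    ring
  have hpow : ‖(exp T ^ k) ^ m‖ ≤ Real.exp (-m) := by
    -- `m = 0` is separate because `‖1‖ = 1` fails when `E` is trivial.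
    rcases Nat.eq_zero_or_pos m with hm | hm
    · rw [hm, pow_zero, Nat.cast_zero, neg_zero, Real.exp_zero]
      exact norm_id_le
    · calc ‖(exp T ^ k) ^ m‖ ≤ ‖exp T ^ k‖ ^ m := norm_pow_le' _ hm
        _ ≤ Real.exp (-1) ^ m := by gcongr
        _ = Real.exp (-m) := by rw [← Real.exp_nat_mul]; ring_nf
  calc ‖exp (t • T)‖ ≤ ‖exp ((t - m * k) • T)‖ * ‖(exp T ^ k) ^ m‖ := by
        rw [hdecomp]; exact norm_mul_le _ _
    _ ≤ (C + 1) * Real.exp (1 + -(1 / k * t)) := by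
        gcongr
        · exact (hC _ ⟨by linarith, by linarith⟩).trans (by linarith)
        · refine hpow.trans (Real.exp_le_exp.2 ?_)
          have : 1 / (k : ℝ) * t = t / k := by ring
          linarith
    _ = _ := by rw [Real.exp_add]; ring

/-- Input-to-state estimate for `ξ' = T ξ + u`, where `exp (t • T)` decays exponentially. -/
theorem norm_le_of_hasDerivWithinAt_add {T : E →L[ℝ] E} {c lam : ℝ} (hc : 0 < c) (hlam : 0 < lam)
    (hT : ∀ t : ℝ, 0 ≤ t → ‖exp (t • T)‖ ≤ c * Real.exp (-(lam * t)))
    {ξ u : ℝ → E} (hξ : ∀ t, 0 ≤ t → HasDerivWithinAt ξ (T (ξ t) + u t) (Set.Ici 0) t)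
    {s t U : ℝ} (hs : 0 ≤ s) (hst : s ≤ t) (hu : ∀ τ ∈ Set.Icc s t, ‖u τ‖ ≤ U) :
    ‖ξ t‖ ≤ c * Real.exp (-(lam * (t - s))) * ‖ξ s‖ + c * U / lam := by
  have hU : 0 ≤ U := (norm_nonneg _).trans (hu s ⟨le_rfl, hst⟩)
  have hexp : ∀ τ, HasDerivAt (fun τ : ℝ ↦ exp ((t - τ) • T)) (-(exp ((t - τ) • T) * T)) τ := by
    intro τ
    have := (hasDerivAt_exp_smul_const T (t - τ)).scomp τ ((hasDerivAt_id τ).const_sub t)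
    simpa [Function.comp_def] using this
  -- The `T` terms cancel in this derivative, and the curve ends at `ξ t` when `τ = t`.
  have hy : ∀ τ, 0 ≤ τ → HasDerivWithinAt (fun τ ↦ exp ((t - τ) • T) (ξ τ))
      (exp ((t - τ) • T) (u τ)) (Set.Ici 0) τ := by
    intro τ hτ
    have := (hexp τ).hasDerivWithinAt.clm_apply (hξ τ hτ)
    convert this using 1
    simp
  -- A majorant whose derivative is exactly the bound on the norm of the derivative above; its value
  -- at `τ = t` is the claimed estimate.
  have hB : ∀ τ, HasDerivAt (fun τ ↦ c * Real.exp (-(lam * (t - s))) * ‖ξ s‖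
      + c * U / lam * Real.exp (-(lam * (t - τ)))) (c * Real.exp (-(lam * (t - τ))) * U) τ := by
    intro τ
    have h1 : HasDerivAt (fun τ ↦ -(lam * (t - τ))) lam τ := by
      have := (((hasDerivAt_id' τ).const_sub t).const_mul lam).fun_neg
      rwa [mul_neg_one, neg_neg] at this
    refine ((h1.exp.const_mul (c * U / lam)).const_add _).congr_deriv ?_
    field_simp
  have key := image_norm_le_of_norm_deriv_right_le_deriv_boundary (a := s) (b := t)
    (fun τ hτ ↦ ((hy τ (hs.trans hτ.1)).continuousWithinAt.mono fun x hx ↦ hs.trans hx.1))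
    (fun τ hτ ↦ (hy τ (hs.trans hτ.1)).mono fun x hx ↦ (hs.trans hτ.1).trans hx) ?_ hB ?_
    (x := t) ⟨hst, le_rfl⟩
  · simpa using key
  · calc _ ≤ ‖exp ((t - s) • T)‖ * ‖ξ s‖ := le_opNorm _ _
      _ ≤ c * Real.exp (-(lam * (t - s))) * ‖ξ s‖ := by
        gcongr; exact hT _ (by linarith)
      _ ≤ _ := le_add_of_nonneg_right (by positivity)
  · intro τ hτ
    calc _ ≤ ‖exp ((t - τ) • T)‖ * ‖u τ‖ := le_opNorm _ _
      _ ≤ _ := by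
        gcongr
        · exact hT _ (by linarith [hτ.2])
        · exact hu τ ⟨hτ.1, hτ.2.le⟩

/-- Variation of constants. -/
theorem exists_hasDerivAt_add (T : E →L[ℝ] E) {u : ℝ → E} (hu : Continuous u) (ξ₀ : E) :
    ∃ ξ : ℝ → E, ξ 0 = ξ₀ ∧ ∀ t, HasDerivAt ξ (T (ξ t) + u t) t := by
  have hcont : Continuous fun τ : ℝ ↦ exp ((-τ) • T) (u τ) :=
    ((continuous_exp_smul T).comp continuous_neg).clm_apply hu
  refine ⟨fun t ↦ exp (t • T) (ξ₀ + ∫ τ in (0 : ℝ)..t, exp ((-τ) • T) (u τ)), by simp, fun t ↦ ?_⟩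
  have h1 := (hcont.integral_hasStrictDerivAt 0 t).hasDerivAt.const_add ξ₀
  convert (hasDerivAt_exp_smul_const' T t).clm_apply h1 using 1
  have h2 : exp (t • T) (exp ((-t) • T) (u t)) = u t := by
    rw [← mul_apply_eq_comp, ← exp_add_smul]
    simp
  rw [h2]
  rfl

end ContinuousLinearMap

/-! ### Stability of the cascade. -/

namespace ADRC

/-- A globally asymptotically stable system driving an exponentially stable linear system forms a
globally asymptotically stable cascade. -/
theorem IsGAS.cascade {E F : Type*} [NormedAddCommGroup E] [NormedSpace ℝ E] [CompleteSpace E]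
    [NormedAddCommGroup F] [NormedSpace ℝ F] {f : F → F} (hf : IsGAS f)
    {T : E →L[ℝ] E} (hT : Tendsto (fun k : ℕ ↦ exp T ^ k) atTop (𝓝 0)) (N : F →L[ℝ] E) :
    IsGAS fun z : E × F ↦ (T z.1 + N z.2, f z.2) := by
  obtain ⟨c, lam, hc, hlam, hdecay⟩ :=
    ContinuousLinearMap.exists_norm_exp_smul_le_of_tendsto_pow hT
  have hsnd : ∀ z : ℝ → E × F, IsForwardSolution (fun z : E × F ↦ (T z.1 + N z.2, f z.2)) z →
      IsForwardSolution f fun t ↦ (z t).2 := fun z hz t ht ↦ (hz t ht).snd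
  have hbound : ∀ z : ℝ → E × F, IsForwardSolution (fun z : E × F ↦ (T z.1 + N z.2, f z.2)) z →
      ∀ {s t U : ℝ}, 0 ≤ s → s ≤ t → (∀ τ ∈ Set.Icc s t, ‖N (z τ).2‖ ≤ U) →
      ‖(z t).1‖ ≤ c * Real.exp (-(lam * (t - s))) * ‖(z s).1‖ + c * U / lam :=
    fun z hz _ _ _ hs hst hU ↦ ContinuousLinearMap.norm_le_of_hasDerivWithinAt_add
      (ξ := fun t ↦ (z t).1) (u := fun t ↦ N (z t).2) hc hlam hdecay
      (fun t ht ↦ (hz t ht).fst) hs hst hU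
  refine ⟨by simp [hf.equilibrium], fun z₀ ↦ ?_, fun ε hε ↦ ?_, fun z hz ↦ ?_⟩
  · obtain ⟨χ, hχ, hχ0⟩ := hf.forward_complete z₀.2
    -- Variation of constants needs an input continuous on all of `ℝ`, while `χ` is controlled only
    -- for `t ≥ 0`; it is frozen at `χ 0` before that.
    have hχc : Continuous fun t ↦ χ (max t 0) := by
      have : ContinuousOn χ (Set.Ici 0) := fun t ht ↦ (hχ t ht).continuousWithinAt
      exact this.comp_continuous (by fun_prop) fun t ↦ Set.mem_Ici.2 (le_max_right _ _)
    obtain ⟨ξ, hξ0, hξ⟩ := T.exists_hasDerivAt_add (N.continuous.comp hχc) z₀.1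
    refine ⟨fun t ↦ (ξ t, χ t), fun t ht ↦ ?_, by simp [hξ0, hχ0]⟩
    have := (hξ t).hasDerivWithinAt (s := Set.Ici 0)
    rw [Function.comp_apply, max_eq_left ht] at this
    exact this.prodMk (hχ t ht)
  · set η : ℝ := min ε (lam * ε / (2 * c * (‖N‖ + 1)))
    have hη : 0 < η := by positivity
    obtain ⟨δ, hδ, hstab⟩ := hf.stable η hη
    refine ⟨min δ (ε / (2 * c)), by positivity, fun z hz hz0 t ht ↦ ?_⟩
    have hz1 : ‖(z 0).1‖ < ε / (2 * c) :=
      (norm_fst_le _).trans_lt (hz0.trans_le (min_le_right _ _))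
    have hχ : ∀ τ, 0 ≤ τ → ‖(z τ).2‖ < η :=
      hstab _ (hsnd z hz) ((norm_snd_le _).trans_lt (hz0.trans_le (min_le_left _ _)))
    have h := hbound z hz le_rfl ht (U := ‖N‖ * η) fun τ hτ ↦
      N.le_opNorm_of_le (hχ τ hτ.1).le
    have hE : Real.exp (-(lam * (t - 0))) ≤ 1 := by
      rw [Real.exp_le_one_iff]; nlinarith
    have h1 : c * Real.exp (-(lam * (t - 0))) * ‖(z 0).1‖ < ε / 2 := by
      calc _ ≤ c * 1 * ‖(z 0).1‖ := by gcongr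
        _ < c * 1 * (ε / (2 * c)) := by gcongr
        _ = ε / 2 := by field_simp
    have h2 : c * (‖N‖ * η) / lam ≤ ε / 2 := by
      calc _ ≤ c * ((‖N‖ + 1) * (lam * ε / (2 * c * (‖N‖ + 1)))) / lam := by
            gcongr
            · linarith
            · exact min_le_right _ _
        _ = ε / 2 := by field_simp
    rw [Prod.norm_def]
    exact max_lt (by linarith) ((hχ t ht).trans_le (min_le_left _ _))
  · have hχ := hf.attractive _ (hsnd z hz)
    refine Tendsto.prodMk_nhds ?_ hχ
    have hu : Tendsto (fun t ↦ ‖N (z t).2‖) atTop (𝓝 0) := by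
      simpa using ((N.continuous.tendsto 0).comp hχ).norm
    rw [Metric.tendsto_nhds]
    intro ε hε
    -- After time `s` the input contributes at most `ε / 2`; restarting the estimate at `s` leaves a
    -- transient that dies out.
    obtain ⟨s, hs⟩ := eventually_atTop.1
      ((hu.eventually_lt_const (show 0 < lam * ε / (2 * c) by positivity)).and
        (eventually_ge_atTop 0))
    have hs0 : 0 ≤ s := (hs s le_rfl).2
    have hlim : Tendsto (fun t ↦ c * Real.exp (-(lam * (t - s))) * ‖(z s).1‖) atTop (𝓝 0) := by
      have : Tendsto (fun t ↦ lam * (t - s)) atTop atTop :=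
        (tendsto_atTop_add_const_right _ (-s) tendsto_id).const_mul_atTop hlam
      simpa using ((Real.tendsto_exp_neg_atTop_nhds_zero.comp this).const_mul c).mul_const ‖(z s).1‖
    filter_upwards [hlim.eventually_lt_const (half_pos hε), eventually_ge_atTop s] with t h1 hst
    have h := hbound z hz hs0 hst fun τ hτ ↦ (hs τ hτ.1).1.le
    have h2 : c * (lam * ε / (2 * c)) / lam = ε / 2 := by field_simp
    rw [dist_zero_right]
    linarith

end ADRC

theorem corollary1 (a : Fin 3 → ℝ) (b bhat : ℝ) (hb : b ≠ 0) (hbhat : bhat ≠ 0)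
    (K : Fin 3 → ℝ) (G : Fin 4 → ℝ)
    (hA : ADRC.IsHurwitz (ADRC.closedLoopMatrix a b bhat K G))
    (M : ℕ) (fd : EuclideanSpace ℝ (Fin M) → EuclideanSpace ℝ (Fin M))
    (hfd : LocallyLipschitz fd) (Cd : Matrix (Fin 1) (Fin M) ℝ)
    (hgas : ADRC.IsGAS fd) :
    ADRC.IsGAS (ADRC.cascadeField a b bhat K G fd Cd) := by
  exact hgas.cascade hA.tendsto_exp_pow
    (Matrix.toEuclideanLin (ADRC.closedLoopInput * Cd)).toContinuousLinearMap
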